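/- Let $G$ be a finite simple graph with $n$ vertices. Suppose that $G$ is $3$-connected (that is, $n\ge 4$, and deleting any set of at most two vertices leaves a connected graph) and edge-pancyclic (that is, for every integer $k$ with $3\le k\le n$, every edge of $G$ lies in a cycle of length $k$). Then $G$ has at least $2n-2$ edges, and $G$ has exactly $2n-2$ edges if and only if $G$ is isomorphic to the wheel $W_n=K_1\vee C_{n-1}$, the graph obtained from a cycle on $n-1$ vertices by adding one new vertex adjacent to every vertex of the cycle. -/

import Mathlib

namespace SimpleGraph

/-- A graph is `k`-connected if it has more than `k` vertices and deleting any set of fewer than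
`k` vertices leaves a connected graph. -/
def IsKConnected {V : Type*} [Fintype V] (G : SimpleGraph V) (k : ℕ) : Prop :=
  k < Fintype.card V ∧ ∀ S : Finset V, S.card < k → (G.induce {v : V | v ∉ S}).Connected

/-- A graph of order `n` is edge-pancyclic if for every integer `k` with `3 ≤ k ≤ n`, every edge
lies in a cycle of length `k`. -/
def IsEdgePancyclic {V : Type*} [Fintype V] (G : SimpleGraph V) : Prop :=
  ∀ k : ℕ, 3 ≤ k → k ≤ Fintype.card V → ∀ e ∈ G.edgeSet,
    ∃ (v : V) (c : G.Walk v v), c.IsCycle ∧ c.length = k ∧ e ∈ c.edges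

/-- The join of two graphs: their disjoint union together with all edges between them. -/
def graphJoin {V W : Type*} (G : SimpleGraph V) (H : SimpleGraph W) : SimpleGraph (V ⊕ W) :=
  (G ⊕g H) ⊔ completeBipartiteGraph V W

/-- The wheel of order `n`: the join of a single vertex with a cycle of order `n - 1`
(meaningful for `n ≥ 4`). -/
def wheel (n : ℕ) : SimpleGraph (Fin 1 ⊕ Fin (n - 1)) :=
  graphJoin (completeGraph (Fin 1)) (cycleGraph (n - 1))

end SimpleGraph

/-! Call two edges equivalent if a chain of triangles joins them. Within one class, starting from a
triangle, each new vertex can be attached across an edge by a triangle, so it brings at least two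
edges: a class on `s` vertices has at least `2s - 3` edges. If there is one class, it grows to all
of `G`. The last vertex brings its whole degree, at least 3 by connectivity, which gives `2n - 2`
(`TriangleGrows.card_edgeSet_ge`). If there are several, each class meets the others in at least
three vertices, since fewer would separate it. Weighting shared vertices 1 and the others 2 then
gives at least `2n` edges (`IsKConnected.two_mul_card_le_of_ne`). Equality therefore forces one
class and a growth without slack: a 2-tree `T`, then a last vertex `c` of degree 3. Triangles on the
edges at `c` make some neighbour `b` of `c` adjacent to the other two. A vertex of degree 2 in `T`
must see `c`, hence is `b` or adjacent to `b`; the structure of 2-trees then makes `b` universal.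
Counting degrees leaves degree 3 elsewhere, and a Hamilton cycle makes `G - b` a cycle. Pancyclicity
is used only for `k = 3` and `k = n`. -/

namespace SimpleGraph

/-! ### Edge counts and growth by triangles -/

section

open scoped Classical

variable {V : Type*}

/-- The neighbours of `x` in `S`. -/
noncomputable def nbrsIn (H : SimpleGraph V) (S : Finset V) (x : V) : Finset V :=
  S.filter (H.Adj x)

lemma mem_nbrsIn {H : SimpleGraph V} {S : Finset V} {x y : V} :
    y ∈ H.nbrsIn S x ↔ y ∈ S ∧ H.Adj x y := by
  simp [nbrsIn]

lemma two_le_card_nbrsIn {H : SimpleGraph V} {S : Finset V} {a b x : V} (ha : a ∈ S) (hb : b ∈ S)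
    (hab : H.Adj a b) (hax : H.Adj a x) (hbx : H.Adj b x) : 2 ≤ (H.nbrsIn S x).card := by
  rw [← Finset.card_pair hab.ne]
  apply Finset.card_le_card
  intro y hy
  simp only [Finset.mem_insert, Finset.mem_singleton] at hy
  rcases hy with rfl | rfl
  · exact mem_nbrsIn.2 ⟨ha, hax.symm⟩
  · exact mem_nbrsIn.2 ⟨hb, hbx.symm⟩

variable [Fintype V]

/-- The edges of `H` with both ends in `S`. -/
noncomputable def edgesIn (H : SimpleGraph V) (S : Finset V) : Finset (Sym2 V) :=
  Finset.univ.filter fun e => e ∈ H.edgeSet ∧ ∀ v ∈ e, v ∈ S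

lemma mk_mem_edgesIn {H : SimpleGraph V} {S : Finset V} {a b : V} :
    s(a, b) ∈ H.edgesIn S ↔ H.Adj a b ∧ a ∈ S ∧ b ∈ S := by
  simp [edgesIn]

lemma card_edgesIn_univ (H : SimpleGraph V) :
    (H.edgesIn Finset.univ).card = H.edgeSet.ncard := by
  rw [← Set.ncard_coe_finset]
  congr 1
  ext e
  simp [edgesIn]

lemma card_edgesIn_insert (H : SimpleGraph V) {S : Finset V} {x : V} (hx : x ∉ S) :
    (H.edgesIn (insert x S)).card = (H.edgesIn S).card + (H.nbrsIn S x).card := by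
  have hinj : Function.Injective fun y : V => s(x, y) := fun y z h => by
    simp only [Sym2.eq_iff] at h
    grind
  have : H.edgesIn (insert x S) = H.edgesIn S ∪ (H.nbrsIn S x).image fun y => s(x, y) := by
    ext e
    induction e with
    | _ a b =>
      simp only [Finset.mem_union, mk_mem_edgesIn, Finset.mem_insert, Finset.mem_image, mem_nbrsIn]
      constructor
      · rintro ⟨h, rfl | ha, rfl | hb⟩
        · exact (H.loopless.irrefl _ h).elim
        · exact Or.inr ⟨b, ⟨hb, h⟩, rfl⟩
        · exact Or.inr ⟨a, ⟨ha, h.symm⟩, Sym2.eq_swap⟩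
        · exact Or.inl ⟨h, ha, hb⟩
      · rintro (⟨h, ha, hb⟩ | ⟨y, ⟨hy, h⟩, he⟩)
        · exact ⟨h, Or.inr ha, Or.inr hb⟩
        · rcases Sym2.eq_iff.1 he with ⟨rfl, rfl⟩ | ⟨rfl, rfl⟩
          · exact ⟨h, Or.inl rfl, Or.inr hy⟩
          · exact ⟨h.symm, Or.inr hy, Or.inl rfl⟩
  rw [this, Finset.card_union_of_disjoint, Finset.card_image_of_injective _ hinj]
  rw [Finset.disjoint_left]
  intro e he he'
  obtain ⟨y, hy, rfl⟩ := Finset.mem_image.1 he'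
  exact hx (mk_mem_edgesIn.1 he).2.1

lemma edgesIn_mono (H : SimpleGraph V) {S T : Finset V} (h : S ⊆ T) :
    H.edgesIn S ⊆ H.edgesIn T := by
  intro e
  simp only [edgesIn, Finset.mem_filter, Finset.mem_univ, true_and]
  exact fun he => ⟨he.1, fun v hv => h (he.2 v hv)⟩

lemma three_le_card_edgesIn_of_triangle {H : SimpleGraph V} {a b c : V} (hab : H.Adj a b)
    (hac : H.Adj a c) (hbc : H.Adj b c) : 3 ≤ (H.edgesIn {a, b, c}).card := by
  have h : ({s(a, b), s(a, c), s(b, c)} : Finset (Sym2 V)) ⊆ H.edgesIn {a, b, c} := by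
    intro e he
    simp only [Finset.mem_insert, Finset.mem_singleton] at he
    rcases he with rfl | rfl | rfl <;> simp [mk_mem_edgesIn, hab, hac, hbc]
  refine le_trans (le_of_eq ?_) (Finset.card_le_card h)
  have := hab.ne; have := hac.ne; have := hbc.ne
  rw [Finset.card_eq_three.2 ⟨s(a, b), s(a, c), s(b, c), ?_, ?_, ?_, rfl⟩] <;> simp <;> grind

/-- Every set of vertices that contains an edge but not all edges is left by a triangle which has
an edge inside it. -/
def TriangleGrows (H : SimpleGraph V) : Prop :=
  ∀ (S : Finset V) (a b p q : V), H.Adj a b → a ∈ S → b ∈ S → H.Adj p q → ¬(p ∈ S ∧ q ∈ S) →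
    ∃ c d x, c ∈ S ∧ d ∈ S ∧ x ∉ S ∧ H.Adj c d ∧ H.Adj c x ∧ H.Adj d x

/-- The vertices that are not isolated. -/
noncomputable def supp (H : SimpleGraph V) : Finset V :=
  Finset.univ.filter fun v => ∃ w, H.Adj v w

lemma mem_supp {H : SimpleGraph V} {v : V} : v ∈ H.supp ↔ ∃ w, H.Adj v w := by
  simp [supp]

/-- Each growth step adds one vertex and at least two edges, so the inequality for `S` persists; `k`
bounds the number of vertices still missing. -/
lemma TriangleGrows.card_supp_le_of {H : SimpleGraph V} (hH : H.TriangleGrows) (k : ℕ) :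
    ∀ (S : Finset V), (Finset.univ \ S).card ≤ k → (∃ a b, a ∈ S ∧ b ∈ S ∧ H.Adj a b) →
      2 * S.card ≤ (H.edgesIn S).card + 3 → 2 * H.supp.card ≤ H.edgeSet.ncard + 3 := by
  induction k with
  | zero =>
    intro S hk _ h
    have : S = Finset.univ := by
      rw [Finset.eq_univ_iff_forall]
      simpa [Finset.ext_iff] using hk
    subst this
    rw [card_edgesIn_univ] at h
    have := Finset.card_le_univ H.supp
    rw [Finset.card_univ] at h
    omega
  | succ k ih =>
    rintro S hk ⟨a, b, ha, hb, hab⟩ h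
    by_cases hsub : H.supp ⊆ S
    · have h1 := Finset.card_le_card hsub
      have h2 := Finset.card_le_card (H.edgesIn_mono S.subset_univ)
      rw [card_edgesIn_univ] at h2
      omega
    · obtain ⟨p, hp, hpS⟩ := Finset.not_subset.1 hsub
      obtain ⟨q, hpq⟩ := mem_supp.1 hp
      obtain ⟨c, d, x, hc, hd, hx, hcd, hcx, hdx⟩ :=
        hH S a b p q hab ha hb hpq fun h => hpS h.1
      refine ih (insert x S) ?_ ⟨a, b, by simp [ha], by simp [hb], hab⟩ ?_
      · have hlt : (Finset.univ \ insert x S).card < (Finset.univ \ S).card := by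
          apply Finset.card_lt_card
          refine ⟨Finset.sdiff_subset_sdiff le_rfl (Finset.subset_insert _ _), fun hh => ?_⟩
          have := hh (Finset.mem_sdiff.2 ⟨Finset.mem_univ x, hx⟩)
          simp at this
        omega
      · rw [Finset.card_insert_of_notMem hx, card_edgesIn_insert H hx]
        have := two_le_card_nbrsIn hc hd hcd hcx hdx
        omega

lemma TriangleGrows.card_supp_le {H : SimpleGraph V} (hH : H.TriangleGrows) {a b c : V}
    (hab : H.Adj a b) (hac : H.Adj a c) (hbc : H.Adj b c) :
    2 * H.supp.card ≤ H.edgeSet.ncard + 3 := by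
  refine hH.card_supp_le_of _ {a, b, c} le_rfl ⟨a, b, by simp, by simp, hab⟩ ?_
  have := three_le_card_edgesIn_of_triangle hab hac hbc
  have := Finset.card_le_three (a := a) (b := b) (c := c)
  omega

/-- Growing an excess: a proper set of vertices that spans `j` edges more than a stacked
triangulation forces as many additional edges in the whole graph. -/
lemma TriangleGrows.card_edgeSet_ge {H : SimpleGraph V} (hH : H.TriangleGrows)
    (hdeg : ∀ x, 3 ≤ (H.nbrsIn Finset.univ x).card) (j k : ℕ) :
    ∀ (S : Finset V), (Finset.univ \ S).card ≤ k → S ≠ Finset.univ →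
      (∃ a b, a ∈ S ∧ b ∈ S ∧ H.Adj a b) →
      2 * S.card + j ≤ (H.edgesIn S).card + 3 →
      2 * Fintype.card V + j ≤ H.edgeSet.ncard + 2 := by
  induction k with
  | zero =>
    intro S hk hS
    exact (hS (by
      rw [Finset.eq_univ_iff_forall]
      simpa [Finset.ext_iff] using hk)).elim
  | succ k ih =>
    rintro S hk hS ⟨a, b, ha, hb, hab⟩ h
    obtain ⟨p, hpS⟩ : ∃ p, p ∉ S := by
      by_contra! hh
      exact hS (Finset.eq_univ_iff_forall.2 hh)
    obtain ⟨q, hq⟩ := Finset.card_pos.1 (lt_of_lt_of_le (by norm_num) (hdeg p))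
    obtain ⟨c, d, x, hc, hd, hx, hcd, hcx, hdx⟩ :=
      hH S a b p q hab ha hb (mem_nbrsIn.1 hq).2 fun h => hpS h.1
    -- The last vertex has all its neighbours in `S`, so it brings three edges instead of two; this
    -- turns the constant 3 into 2.
    by_cases hu : insert x S = Finset.univ
    · have h1 := card_edgesIn_insert H hx
      have h2 := Finset.card_insert_of_notMem hx
      have h3 : H.nbrsIn S x = H.nbrsIn Finset.univ x := by
        rw [← hu]
        ext y
        simp only [mem_nbrsIn, Finset.mem_insert]
        constructor
        · exact fun h => ⟨Or.inr h.1, h.2⟩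
        · rintro ⟨rfl | hy, h⟩
          · exact (H.loopless.irrefl _ h).elim
          · exact ⟨hy, h⟩
      rw [hu, card_edgesIn_univ, h3] at h1
      rw [hu, Finset.card_univ] at h2
      have := hdeg x
      omega
    refine ih (insert x S) ?_ hu ⟨a, b, by simp [ha], by simp [hb], hab⟩ ?_
    · have hlt : (Finset.univ \ insert x S).card < (Finset.univ \ S).card := by
        apply Finset.card_lt_card
        refine ⟨Finset.sdiff_subset_sdiff le_rfl (Finset.subset_insert _ _), fun hh => ?_⟩
        have := hh (Finset.mem_sdiff.2 ⟨Finset.mem_univ x, hx⟩)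
        simp at this
      omega
    · rw [Finset.card_insert_of_notMem hx, card_edgesIn_insert H hx]
      have := two_le_card_nbrsIn hc hd hcd hcx hdx
      omega

end

/-! ### Stacked sets and their vertices of degree two -/

section

open scoped Classical

variable {V : Type*}

/-- Sets of vertices obtained from a triangle by repeatedly adding a vertex whose neighbours among
the earlier ones are the two ends of an edge; they induce `2`-trees. -/
inductive IsStacked (G : SimpleGraph V) : Finset V → Prop
  | triangle {a b c : V} : G.Adj a b → G.Adj a c → G.Adj b c → IsStacked G {a, b, c}
  | stack {S : Finset V} {x a b : V} : IsStacked G S → x ∉ S → a ∈ S → b ∈ S → G.Adj a b →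
      G.nbrsIn S x = {a, b} → IsStacked G (insert x S)

lemma nbrsIn_insert_of_not_adj {G : SimpleGraph V} {S : Finset V} {x u : V} (h : ¬G.Adj u x) :
    G.nbrsIn (insert x S) u = G.nbrsIn S u := by
  ext y
  simp only [mem_nbrsIn, Finset.mem_insert]
  constructor
  · rintro ⟨rfl | hy, hu⟩
    · exact (h hu).elim
    · exact ⟨hy, hu⟩
  · exact fun hy => ⟨Or.inr hy.1, hy.2⟩

lemma nbrsIn_insert_self {G : SimpleGraph V} {S : Finset V} {x : V} :
    G.nbrsIn (insert x S) x = G.nbrsIn S x :=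
  nbrsIn_insert_of_not_adj (G.loopless.irrefl x)

lemma not_adj_of_nbrsIn_eq {G : SimpleGraph V} {S : Finset V} {x a b u : V}
    (h : G.nbrsIn S x = {a, b}) (hu : u ∈ S) (hua : u ≠ a) (hub : u ≠ b) : ¬G.Adj u x := by
  intro hux
  have : u ∈ G.nbrsIn S x := mem_nbrsIn.2 ⟨hu, hux.symm⟩
  simp [h, hua, hub] at this

lemma card_nbrsIn_triangle_le {G : SimpleGraph V} {a b c u : V}
    (hu : u ∈ ({a, b, c} : Finset V)) : (G.nbrsIn {a, b, c} u).card ≤ 2 := by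
  have h1 : G.nbrsIn {a, b, c} u ⊆ ({a, b, c} : Finset V).erase u := by
    intro y hy
    obtain ⟨h, h'⟩ := mem_nbrsIn.1 hy
    exact Finset.mem_erase.2 ⟨h'.ne', h⟩
  have h2 := Finset.card_le_card h1
  rw [Finset.card_erase_of_mem hu] at h2
  have := Finset.card_le_three (a := a) (b := b) (c := c)
  omega

/-- The newest vertex `x` has degree 2 and serves every edge avoiding it. An edge at `x` ends at `a`
or `b`, and an older leaf off the edge `ab` misses `x` and keeps its degree. -/
lemma IsStacked.exists_leaf_off_edge {G : SimpleGraph V} {S : Finset V} (hS : G.IsStacked S) :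
    ∀ p q, p ∈ S → q ∈ S → G.Adj p q →
      ∃ u ∈ S, u ≠ p ∧ u ≠ q ∧ (G.nbrsIn S u).card ≤ 2 := by
  induction hS with
  | @triangle a b c hab hac hbc =>
    intro p q hp hq hpq
    have hex : ∃ u ∈ ({a, b, c} : Finset V), u ≠ p ∧ u ≠ q := by
      have := hab.ne; have := hac.ne; have := hbc.ne; have := hpq.ne
      simp only [Finset.mem_insert, Finset.mem_singleton, exists_eq_or_imp,
        exists_eq_left] at hp hq ⊢
      grind
    obtain ⟨u, hu, hup, huq⟩ := hex
    exact ⟨u, hu, hup, huq, card_nbrsIn_triangle_le hu⟩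
  | @stack S x a b _ hx ha hb hab hN ih =>
    have hxleaf : (G.nbrsIn (insert x S) x).card ≤ 2 := by
      rw [nbrsIn_insert_self, hN]
      exact Finset.card_le_two
    have key : ∃ u ∈ insert x S, u ≠ x ∧ u ≠ a ∧ u ≠ b ∧ (G.nbrsIn (insert x S) u).card ≤ 2 := by
      obtain ⟨u, hu, hua, hub, hl⟩ := ih a b ha hb hab
      refine ⟨u, Finset.mem_insert_of_mem hu, fun h => hx (h ▸ hu), hua, hub, ?_⟩
      rwa [nbrsIn_insert_of_not_adj (not_adj_of_nbrsIn_eq hN hu hua hub)]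
    have hnb : ∀ y ∈ S, G.Adj x y → y = a ∨ y = b := by
      intro y hy hxy
      have : y ∈ G.nbrsIn S x := mem_nbrsIn.2 ⟨hy, hxy⟩
      simpa [hN] using this
    intro p q hp hq hpq
    by_cases hpx : p = x
    · obtain ⟨u, hu, hux, hua, hub, hl⟩ := key
      subst hpx
      have hqS : q ∈ S := (Finset.mem_insert.1 hq).resolve_left hpq.ne'
      refine ⟨u, hu, hux, ?_, hl⟩
      rcases hnb q hqS hpq with rfl | rfl <;> assumption
    by_cases hqx : q = x
    · obtain ⟨u, hu, hux, hua, hub, hl⟩ := key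
      subst hqx
      have hpS : p ∈ S := (Finset.mem_insert.1 hp).resolve_left hpx
      refine ⟨u, hu, ?_, hux, hl⟩
      rcases hnb p hpS hpq.symm with rfl | rfl <;> assumption
    exact ⟨x, Finset.mem_insert_self _ _, Ne.symm hpx, Ne.symm hqx, hxleaf⟩

/-- When `x` is stacked on `pq`, it is itself the required leaf unless `b` is `x` or a neighbour of
`x`. If `b = x`, a leaf off `pq` serves; if `b` is `p` or `q`, an earlier leaf not adjacent to `b`
survives. -/
lemma IsStacked.universal_or_exists_leaf {G : SimpleGraph V} {S : Finset V} (hS : G.IsStacked S) :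
    ∀ b ∈ S, (∀ v ∈ S, v ≠ b → G.Adj b v) ∨
      ∃ u ∈ S, u ≠ b ∧ ¬G.Adj b u ∧ (G.nbrsIn S u).card ≤ 2 := by
  induction hS with
  | @triangle a b c hab hac hbc =>
    intro p hp
    left
    intro v hv hvp
    have := hab.symm; have := hac.symm; have := hbc.symm
    simp only [Finset.mem_insert, Finset.mem_singleton] at hp hv
    grind
  | @stack S x p q hS hx hp hq hpq hN ih =>
    have hxleaf : (G.nbrsIn (insert x S) x).card ≤ 2 := by
      rw [nbrsIn_insert_self, hN]
      exact Finset.card_le_two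
    intro b hb
    by_cases hbx : b = x
    · subst hbx
      obtain ⟨u, hu, hup, huq, hl⟩ := hS.exists_leaf_off_edge p q hp hq hpq
      have hub := not_adj_of_nbrsIn_eq hN hu hup huq
      refine Or.inr ⟨u, Finset.mem_insert_of_mem hu, fun h => hx (h ▸ hu), fun h => hub h.symm, ?_⟩
      rwa [nbrsIn_insert_of_not_adj hub]
    have hbS : b ∈ S := (Finset.mem_insert.1 hb).resolve_left hbx
    by_cases hadj : G.Adj b x
    · rcases ih b hbS with h | ⟨u, hu, hub, hbu, hl⟩
      · left
        intro v hv hvb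
        rcases Finset.mem_insert.1 hv with rfl | hv
        · exact hadj
        · exact h v hv hvb
      · right
        -- Otherwise `u` and `b` would be the two ends of `pq`, hence adjacent.
        have hux : ¬G.Adj u x := by
          intro hux
          have h1 : u ∈ G.nbrsIn S x := mem_nbrsIn.2 ⟨hu, hux.symm⟩
          have h2 : b ∈ G.nbrsIn S x := mem_nbrsIn.2 ⟨hbS, hadj.symm⟩
          have := hpq.symm
          simp only [hN, Finset.mem_insert, Finset.mem_singleton] at h1 h2
          grind
        refine ⟨u, Finset.mem_insert_of_mem hu, hub, hbu, ?_⟩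
        rwa [nbrsIn_insert_of_not_adj hux]
    · exact Or.inr ⟨x, Finset.mem_insert_self _ _, Ne.symm hbx, hadj, hxleaf⟩

/-! ### Consequences of connectivity and pancyclicity -/

variable [Fintype V]

/-- A vertex property preserved by adjacency outside a separating set of at most two vertices of a
`3`-connected graph holds everywhere outside it. -/
lemma IsKConnected.propagate {G : SimpleGraph V} (hG : G.IsKConnected 3) {A : Finset V}
    (hA : A.card < 3) {P : V → Prop}
    (hP : ∀ x y, P x → x ∉ A → y ∉ A → G.Adj x y → P y) {u w : V} (hu : u ∉ A) (hw : w ∉ A)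
    (hPu : P u) : P w := by
  obtain ⟨p⟩ := (hG.2 A hA).preconnected ⟨u, hu⟩ ⟨w, hw⟩
  have : ∀ (x y : {v : V | v ∉ A}), (G.induce {v : V | v ∉ A}).Walk x y → P x → P y := by
    intro x y p
    induction p with
    | nil => exact id
    | @cons x y z h _ ih => exact fun hx => ih (hP _ _ hx x.2 y.2 h)
  exact this _ _ p hPu

lemma IsKConnected.three_le_card_nbrsIn {G : SimpleGraph V} (hG : G.IsKConnected 3) (x : V) :
    3 ≤ (G.nbrsIn Finset.univ x).card := by
  by_contra! h
  obtain ⟨w, hw⟩ : ∃ w, w ∉ insert x (G.nbrsIn Finset.univ x) := by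
    by_contra! hh
    have h1 := Finset.card_insert_le x (G.nbrsIn Finset.univ x)
    rw [Finset.eq_univ_iff_forall.2 hh, Finset.card_univ] at h1
    have := hG.1
    omega
  simp only [Finset.mem_insert, not_or] at hw
  -- Deleting the neighbours of `x` isolates it from `w`.
  refine hw.1 (hG.propagate (P := (· = x)) h ?_ (u := x) (w := w) ?_ hw.2 rfl)
  · rintro _ y rfl _ hy hxy
    exact (hy (mem_nbrsIn.2 ⟨Finset.mem_univ _, hxy⟩)).elim
  · simp [mem_nbrsIn]

lemma IsEdgePancyclic.exists_triangle {G : SimpleGraph V} (hG : G.IsEdgePancyclic)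
    (hn : 3 ≤ Fintype.card V) {a b : V} (hab : G.Adj a b) : ∃ c, G.Adj a c ∧ G.Adj b c := by
  obtain ⟨v, c, _, hc, he⟩ := hG 3 le_rfl hn s(a, b) hab
  match c, hc with
  | .cons (v := x) h1 (.cons (v := y) h2 (.cons h3 .nil)), _ =>
    simp only [Walk.edges_cons, Walk.edges_nil, List.mem_cons, List.not_mem_nil, or_false,
      Sym2.eq_iff] at he
    have := h1.symm; have := h2.symm; have := h3.symm
    grind

end

/-! ### The wheel and the case of equality -/

section

open scoped Classical

lemma wheel_adj_inl_inr (n : ℕ) (x : Fin 1) (i : Fin (n - 1)) :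
    (wheel n).Adj (.inl x) (.inr i) := by
  simp [wheel, graphJoin]

lemma wheel_adj_inr_inr {n : ℕ} (i j : Fin (n - 1)) :
    (wheel n).Adj (.inr i) (.inr j) ↔ (cycleGraph (n - 1)).Adj i j := by
  simp [wheel, graphJoin]

lemma wheel_not_adj_inl_inl {n : ℕ} (x y : Fin 1) : ¬(wheel n).Adj (.inl x) (.inl y) := by
  have := Subsingleton.elim x y
  simp [this]

lemma ncard_edgeSet_wheel (m : ℕ) : (wheel (m + 4)).edgeSet.ncard = 2 * m + 6 := by
  have hsum := (wheel (m + 4)).sum_degrees_eq_twice_card_edges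
  have hl : ∀ x : Fin 1, (wheel (m + 4)).degree (.inl x) = m + 3 := by
    intro x
    have : (wheel (m + 4)).neighborFinset (.inl x) = Finset.univ.map Function.Embedding.inr := by
      ext (y | y)
      · simpa [mem_neighborFinset] using wheel_not_adj_inl_inl x y
      · simpa [mem_neighborFinset] using wheel_adj_inl_inr (m + 4) x y
    rw [← card_neighborFinset_eq_degree, this]
    simp
  have hr : ∀ i : Fin (m + 4 - 1), (wheel (m + 4)).degree (.inr i) = 3 := by
    intro i
    have : (wheel (m + 4)).neighborFinset (.inr i) =
        insert (.inl 0) (((cycleGraph (m + 3)).neighborFinset i).map Function.Embedding.inr) := by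
      ext (y | y)
      · simp [mem_neighborFinset, (wheel_adj_inl_inr _ _ _).symm, Subsingleton.elim y 0]
      · simpa [mem_neighborFinset] using wheel_adj_inr_inr (n := m + 4) i y
    rw [← card_neighborFinset_eq_degree, this, Finset.card_insert_of_notMem (by simp),
      Finset.card_map, card_neighborFinset_eq_degree]
    have := cycleGraph_degree_three_le (v := (i : Fin (m + 3)))
    convert congrArg (· + 1) this
  rw [Fintype.sum_sum_type, Finset.sum_congr rfl fun x _ => hl x,
    Finset.sum_congr rfl fun i _ => hr i] at hsum
  simp only [Finset.sum_const, Finset.card_univ, Fintype.card_fin, smul_eq_mul] at hsum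
  rw [← coe_edgeFinset, Set.ncard_coe_finset]
  omega

variable {V : Type*}

lemma IsStacked.exists_adj {G : SimpleGraph V} {S : Finset V} (hS : G.IsStacked S) :
    ∃ a b, a ∈ S ∧ b ∈ S ∧ G.Adj a b := by
  cases hS with
  | @triangle a b c hab _ _ => exact ⟨a, b, by simp, by simp, hab⟩
  | @stack S x a b _ hx ha hb hab hN => exact ⟨a, b, by simp [ha], by simp [hb], hab⟩

variable [Fintype V]

lemma IsStacked.exists_extension_compl_singleton {G : SimpleGraph V} (hG : G.TriangleGrows)
    (hdeg : ∀ x, 3 ≤ (G.nbrsIn Finset.univ x).card)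
    (hE : G.edgeSet.ncard + 2 ≤ 2 * Fintype.card V) (k : ℕ) :
    ∀ S : Finset V, (Finset.univ \ S).card ≤ k → S ≠ Finset.univ → G.IsStacked S →
      2 * S.card ≤ (G.edgesIn S).card + 3 →
      ∃ T c, G.IsStacked T ∧ c ∉ T ∧ insert c T = Finset.univ ∧
        2 * T.card ≤ (G.edgesIn T).card + 3 := by
  induction k with
  | zero =>
    intro S hk hS
    exact (hS (by
      rw [Finset.eq_univ_iff_forall]
      simpa [Finset.ext_iff] using hk)).elim
  | succ k ih =>
    intro S hk hS hst h
    obtain ⟨a, b, ha, hb, hab⟩ := hst.exists_adj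
    obtain ⟨p, hpS⟩ : ∃ p, p ∉ S := by
      by_contra! hh
      exact hS (Finset.eq_univ_iff_forall.2 hh)
    obtain ⟨q, hq⟩ := Finset.card_pos.1 (lt_of_lt_of_le (by norm_num) (hdeg p))
    obtain ⟨c, d, x, hc, hd, hx, hcd, hcx, hdx⟩ :=
      hG S a b p q hab ha hb (mem_nbrsIn.1 hq).2 fun h => hpS h.1
    by_cases hu : insert x S = Finset.univ
    · exact ⟨S, x, hst, hx, hu, h⟩
    have h1 := card_edgesIn_insert G hx
    have h2 := Finset.card_insert_of_notMem hx
    have h3 := two_le_card_nbrsIn hc hd hcd hcx hdx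
    have h4 : (G.nbrsIn S x).card ≤ 2 := by
      by_contra! h4
      -- A third neighbour of `x` would be an excess `j = 1`, which persists to the end and
      -- contradicts `hE`.
      have := hG.card_edgeSet_ge hdeg 1 _ (insert x S) le_rfl hu
        ⟨a, b, by simp [ha], by simp [hb], hab⟩ (by omega)
      omega
    have hN : G.nbrsIn S x = {c, d} := by
      refine (Finset.eq_of_subset_of_card_le ?_ ?_).symm
      · intro y hy
        simp only [Finset.mem_insert, Finset.mem_singleton] at hy
        rcases hy with rfl | rfl
        · exact mem_nbrsIn.2 ⟨hc, hcx.symm⟩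
        · exact mem_nbrsIn.2 ⟨hd, hdx.symm⟩
      · rwa [Finset.card_pair hcd.ne]
    refine ih (insert x S) ?_ hu (hst.stack hx hc hd hcd hN) (by omega)
    have hlt : (Finset.univ \ insert x S).card < (Finset.univ \ S).card := by
      apply Finset.card_lt_card
      refine ⟨Finset.sdiff_subset_sdiff le_rfl (Finset.subset_insert _ _), fun hh => ?_⟩
      have := hh (Finset.mem_sdiff.2 ⟨Finset.mem_univ x, hx⟩)
      simp at this
    omega

lemma nbrsIn_univ_eq {G : SimpleGraph V} {T : Finset V} {c : V} (h : insert c T = Finset.univ) :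
    G.nbrsIn Finset.univ c = G.nbrsIn T c := by
  rw [← h, nbrsIn_insert_self]

lemma TriangleGrows.exists_universal {G : SimpleGraph V} (hG : G.TriangleGrows)
    (hn : 4 ≤ Fintype.card V) (hdeg : ∀ x, 3 ≤ (G.nbrsIn Finset.univ x).card)
    (htri : ∀ a b, G.Adj a b → ∃ c, G.Adj a c ∧ G.Adj b c)
    (hE : G.edgeSet.ncard + 2 = 2 * Fintype.card V) : ∃ b, ∀ v, v ≠ b → G.Adj b v := by
  obtain ⟨x₀⟩ : Nonempty V := Fintype.card_pos_iff.1 (by omega)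
  obtain ⟨y₀, hy₀⟩ := Finset.card_pos.1 (lt_of_lt_of_le (by norm_num) (hdeg x₀))
  have h₀ := (mem_nbrsIn.1 hy₀).2
  obtain ⟨z₀, hxz, hyz⟩ := htri _ _ h₀
  have hc3 := Finset.card_le_three (a := x₀) (b := y₀) (c := z₀)
  obtain ⟨T, c, hT, hc, hu, hTc⟩ := IsStacked.exists_extension_compl_singleton hG hdeg hE.le _
    {x₀, y₀, z₀} le_rfl (fun h => by rw [h, Finset.card_univ] at hc3; omega)
    (.triangle h₀ hxz hyz) (by have := three_le_card_edgesIn_of_triangle h₀ hxz hyz; omega)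
  -- `T` has `n - 1` vertices and at least `2n - 5` of the `2n - 2` edges.
  have hN : (G.nbrsIn T c).card = 3 := by
    have h1 := card_edgesIn_insert G hc
    have h2 := Finset.card_insert_of_notMem hc
    have h3 := hdeg c
    rw [nbrsIn_univ_eq hu] at h3
    rw [hu, card_edgesIn_univ] at h1
    rw [hu, Finset.card_univ] at h2
    omega
  have hpartner : ∀ v ∈ G.nbrsIn T c, ∃ w ∈ G.nbrsIn T c, G.Adj v w := by
    intro v hv
    obtain ⟨w, hcw, hvw⟩ := htri c v (mem_nbrsIn.1 hv).2
    refine ⟨w, ?_, hvw⟩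
    rw [← nbrsIn_univ_eq hu]
    exact mem_nbrsIn.2 ⟨Finset.mem_univ _, hcw⟩
  -- A graph on three vertices with none isolated has a vertex adjacent to the other two.
  obtain ⟨b, hb, hbN⟩ : ∃ b ∈ G.nbrsIn T c, ∀ v ∈ G.nbrsIn T c, v ≠ b → G.Adj b v := by
    obtain ⟨x, y, z, -, -, -, hxyz⟩ := Finset.card_eq_three.1 hN
    rw [hxyz] at hpartner ⊢
    simp only [Finset.mem_insert, Finset.mem_singleton, forall_eq_or_imp, forall_eq,
      exists_eq_or_imp, exists_eq_left] at hpartner ⊢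
    have hs : ∀ u v, G.Adj u v ↔ G.Adj v u := G.adj_comm
    have hi : ∀ u, ¬G.Adj u u := G.loopless.irrefl
    grind
  have hbT := (mem_nbrsIn.1 hb).1
  refine ⟨b, fun v hv => ?_⟩
  rcases Finset.mem_insert.1 (hu ▸ Finset.mem_univ v) with rfl | hvT
  · exact (mem_nbrsIn.1 hb).2.symm
  rcases hT.universal_or_exists_leaf b hbT with h | ⟨u, huT, hub, hbu, hl⟩
  · exact h v hvT hv
  -- The leaf `u` has degree at least 3 in `G` but at most 2 in `T`, so it is adjacent to `c`.
  · refine (hbu (hbN u ?_ hub)).elim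
    by_contra hcu
    have hcu' : ¬G.Adj u c := fun h => hcu (mem_nbrsIn.2 ⟨huT, h.symm⟩)
    have := hdeg u
    rw [← hu, nbrsIn_insert_of_not_adj hcu'] at this
    omega

lemma card_nbrsIn_univ (G : SimpleGraph V) (x : V) :
    (G.nbrsIn Finset.univ x).card = G.degree x := by
  rw [← card_neighborFinset_eq_degree]
  congr 1
  ext y
  simp [mem_nbrsIn]

/-- The degree sum is `4n - 4` and `b` takes `n - 1`, leaving an average of exactly 3 for the
others. -/
lemma degree_eq_three_of_universal {G : SimpleGraph V}
    (hdeg : ∀ x, 3 ≤ G.degree x) (hE : G.edgeSet.ncard + 2 = 2 * Fintype.card V) {b : V}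
    (hb : ∀ v, v ≠ b → G.Adj b v) {v : V} (hv : v ≠ b) : G.degree v = 3 := by
  have hsum := G.sum_degrees_eq_twice_card_edges
  rw [← Set.ncard_coe_finset, coe_edgeFinset, ← Finset.add_sum_erase _ _ (Finset.mem_univ b)] at hsum
  have hdb : G.degree b = (Finset.univ.erase b).card := by
    rw [← card_neighborFinset_eq_degree]
    congr 1
    ext v
    simp only [mem_neighborFinset, Finset.mem_erase, Finset.mem_univ, and_true]
    exact ⟨fun h => h.ne', hb v⟩
  have hc : (Finset.univ.erase b).card + 1 = Fintype.card V :=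
    Finset.card_erase_add_one (Finset.mem_univ b)
  have hle : ∀ w ∈ Finset.univ.erase b, 3 ≤ G.degree w := fun w _ => hdeg w
  have heq : ∑ w ∈ Finset.univ.erase b, 3 = ∑ w ∈ Finset.univ.erase b, G.degree w := by
    rw [Finset.sum_const, smul_eq_mul]
    omega
  exact ((Finset.sum_eq_sum_iff_of_le hle).1 heq v (by simp [hv])).symm

/-- A graph with a Hamilton cycle and a universal vertex, all of whose other vertices have
degree `3`, is a wheel. -/
lemma nonempty_iso_wheel {G : SimpleGraph V} {m : ℕ} (hn : Fintype.card V = m + 4)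
    (hham : cycleGraph (m + 4) ⊑ G) {b : V} (hb : ∀ v, v ≠ b → G.Adj b v)
    (hdeg : ∀ v, v ≠ b → G.degree v = 3) : Nonempty (G ≃g wheel (m + 4)) := by
  obtain ⟨φ⟩ := hham
  have hφ : Function.Bijective φ :=
    (Fintype.bijective_iff_injective_and_card _).2 ⟨φ.injective, by simp [hn]⟩
  obtain ⟨i₀, hi₀⟩ := hφ.2 b
  -- The other vertices in their order along the Hamilton cycle after `b`; they form a path whose
  -- ends remain to be joined.
  let r : Fin (m + 3) → V := fun j => φ (i₀ + j.succ)
  have hrinj : Function.Injective r := fun i j h => by simpa [r] using φ.injective h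
  have hrb : ∀ j, r j ≠ b := fun j h => by
    have := φ.injective (h.trans hi₀.symm)
    simp at this
  have hpath : ∀ i, i ≠ Fin.last _ → G.Adj (r i) (r (i + 1)) := by
    intro i hi
    refine φ.toHom.map_adj (cycleGraph_adj.2 (Or.inr ?_))
    have : (i + 1).succ = i.succ + 1 := by
      ext
      rw [Fin.val_succ, Fin.val_add_one_of_lt (Fin.lt_last_iff_ne_last.2 hi),
        Fin.val_add_one_of_lt]
      · simp
      · rw [Fin.lt_last_iff_ne_last]
        simpa [← Fin.succ_last] using hi
    rw [this]
    abel
  have hsurj : ∀ v, v ≠ b → ∃ j, r j = v := by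
    have himg : Finset.univ.image r = Finset.univ.erase b := by
      refine Finset.eq_of_subset_of_card_le (fun v hv => ?_) ?_
      · obtain ⟨j, -, rfl⟩ := Finset.mem_image.1 hv
        simp [hrb]
      · rw [Finset.card_erase_of_mem (Finset.mem_univ b), Finset.card_image_of_injective _ hrinj]
        simp [hn]
    intro v hv
    have : v ∈ Finset.univ.image r := by rw [himg]; simp [hv]
    simpa using this
  have hthree : ∀ i x y z, G.Adj (r i) (r x) → G.Adj (r i) (r y) → G.Adj (r i) (r z) →
      x ≠ y → x ≠ z → y ≠ z → False := by
    intro i x y z hx hy hz hxy hxz hyz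
    have hsub : ({b, r x, r y, r z} : Finset V) ⊆ G.neighborFinset (r i) := by
      intro v hv
      simp only [Finset.mem_insert, Finset.mem_singleton] at hv
      rw [mem_neighborFinset]
      rcases hv with rfl | rfl | rfl | rfl
      exacts [(hb _ (hrb i)).symm, hx, hy, hz]
    have := Finset.card_le_card hsub
    rw [card_neighborFinset_eq_degree, hdeg _ (hrb i), Finset.card_insert_of_notMem,
      Finset.card_insert_of_notMem, Finset.card_pair] at this
    · omega
    · exact fun h => hyz (hrinj h)
    · simp [hrinj.eq_iff, hxy, hxz]
    · simp [(hrb _).symm]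
  have hpredsucc : ∀ i : Fin (m + 3), i - 1 ≠ i + 1 := by
    intro i h
    have : (1 : Fin (m + 3)) + 1 = 0 := by
      have := sub_eq_iff_eq_add.1 h
      rw [add_assoc] at this
      simpa using this.symm
    simp only [Fin.ext_iff, Fin.val_add, Fin.val_one, Fin.val_zero] at this
    rw [Nat.mod_eq_of_lt (by omega)] at this
    omega
  -- Besides `b` and `r 1`, `r 0` has a third neighbour. An inner vertex of the path already has two
  -- path neighbours and `b`, so it must be the last one.
  have hclose : G.Adj (r (Fin.last _)) (r 0) := by
    obtain ⟨v, hv, hv'⟩ : ∃ v ∈ G.neighborFinset (r 0), v ∉ ({b, r 1} : Finset V) := by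
      by_contra! h
      have := (Finset.card_le_card h).trans Finset.card_le_two
      rw [card_neighborFinset_eq_degree, hdeg _ (hrb 0)] at this
      omega
    simp only [Finset.mem_insert, Finset.mem_singleton, not_or] at hv'
    obtain ⟨j, rfl⟩ := hsurj v hv'.1
    rw [mem_neighborFinset] at hv
    by_cases hj : j = Fin.last _
    · exact hj ▸ hv.symm
    have hj1 : j ≠ 1 := fun h => hv'.2 (h ▸ rfl)
    have hj0 : j ≠ 0 := fun h => hv.ne (h ▸ rfl)
    have hpred : j - 1 ≠ Fin.last _ := by
      intro h
      apply hj0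
      rw [← sub_add_cancel j 1, h, Fin.last_add_one]
    have h1 := hpath (j - 1) hpred
    rw [sub_add_cancel] at h1
    refine (hthree j (j - 1) (j + 1) 0 h1.symm (hpath j hj) hv.symm ?_ ?_ ?_).elim
    · exact hpredsucc _
    · intro h
      exact hj1 (sub_eq_zero.1 h)
    · intro h
      apply hj
      rw [← add_left_inj 1, h, Fin.last_add_one]
  have hcyc : ∀ i, G.Adj (r i) (r (i + 1)) := by
    intro i
    by_cases hi : i = Fin.last _
    · rw [hi, Fin.last_add_one]
      exact hclose
    · exact hpath i hi
  have hiff : ∀ i j, G.Adj (r i) (r j) ↔ (cycleGraph (m + 3)).Adj i j := by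
    intro i j
    rw [cycleGraph_adj]
    have hp := hcyc (i - 1)
    rw [sub_add_cancel] at hp
    constructor
    · intro h
      by_contra! hne
      refine hthree i (i - 1) (i + 1) j hp.symm (hcyc i) h ?_ ?_ ?_
      · exact hpredsucc _
      · rintro rfl
        exact hne.1 (by abel)
      · rintro rfl
        exact hne.2 (by abel)
    · rintro (h | h)
      · rw [sub_eq_iff_eq_add'.1 h, add_comm]
        simpa [add_comm] using (hcyc j).symm
      · rw [sub_eq_iff_eq_add'.1 h]
        exact hcyc i
  let f : Fin 1 ⊕ Fin (m + 3) → V := Sum.elim (fun _ => b) r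
  have hf : Function.Bijective f := by
    refine (Fintype.bijective_iff_injective_and_card _).2 ⟨?_, by simp [hn]; omega⟩
    exact Function.Injective.sumElim (Function.injective_of_subsingleton _) hrinj
      fun _ j => (hrb j).symm
  refine ⟨(RelIso.symm ⟨Equiv.ofBijective f hf, ?_⟩ : G ≃g wheel (m + 4))⟩
  rintro (x | i) (y | j)
  · simpa [f] using wheel_not_adj_inl_inl x y
  · simpa [f, hb _ (hrb j)] using wheel_adj_inl_inr (m + 4) x j
  · simpa [f, (wheel_adj_inl_inr _ _ _).symm] using (hb _ (hrb i)).symm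
  · rw [wheel_adj_inr_inr]
    exact hiff i j

end

/-! ### Classes of edges joined by triangles -/

section

open scoped Classical

variable {V : Type*}

/-- Two edges are related if they are sides of a common triangle. -/
def ShareTriangle (G : SimpleGraph V) (e f : Sym2 V) : Prop :=
  ∃ a b c, G.Adj a b ∧ G.Adj a c ∧ G.Adj b c ∧ e = s(a, b) ∧ f = s(a, c)

lemma ShareTriangle.symm {G : SimpleGraph V} {e f : Sym2 V} (h : G.ShareTriangle e f) :
    G.ShareTriangle f e := by
  obtain ⟨a, b, c, hab, hac, hbc, rfl, rfl⟩ := h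
  exact ⟨a, c, b, hac, hab, hbc.symm, rfl, rfl⟩

/-- Edges joined by a chain of triangles. -/
def triangleSetoid (G : SimpleGraph V) : Setoid (Sym2 V) where
  r := Relation.ReflTransGen G.ShareTriangle
  iseqv :=
    ⟨fun _ => .refl, fun h => (@Relation.ReflTransGen.stdSymm _ _ ⟨fun _ _ h => h.symm⟩).symm _ _ h,
      fun h h' => h.trans h'⟩

/-- The spanning subgraph formed by a class of edges joined by chains of triangles. -/
def triangleClass (G : SimpleGraph V) (i : Quotient G.triangleSetoid) : SimpleGraph V where
  Adj x y := G.Adj x y ∧ Quotient.mk _ s(x, y) = i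
  symm := ⟨fun x _ h => ⟨h.1.symm, Sym2.eq_swap (a := x) ▸ h.2⟩⟩
  loopless := ⟨fun x h => G.loopless.irrefl x h.1⟩

lemma ShareTriangle.mk_eq {G : SimpleGraph V} {e f : Sym2 V} (h : G.ShareTriangle e f) :
    (Quotient.mk G.triangleSetoid e) = Quotient.mk _ f :=
  Quotient.sound (Relation.ReflTransGen.single h)

lemma triangleClass_of_triangle {G : SimpleGraph V} {i : Quotient G.triangleSetoid} {a b c : V}
    (h : (G.triangleClass i).Adj a b) (hac : G.Adj a c) (hbc : G.Adj b c) :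
    (G.triangleClass i).Adj a c ∧ (G.triangleClass i).Adj b c := by
  obtain ⟨hab, rfl⟩ := h
  refine ⟨⟨hac, ?_⟩, ⟨hbc, ?_⟩⟩
  · exact (ShareTriangle.mk_eq ⟨a, b, c, hab, hac, hbc, rfl, rfl⟩).symm
  · exact (ShareTriangle.mk_eq ⟨b, a, c, hab.symm, hbc, hac, Sym2.eq_swap, rfl⟩).symm

/-- If no triangle of the class left `S`, then every edge of a triangle chain from `ab` would stay
inside `S`, including `pq`. -/
lemma triangleGrows_triangleClass (G : SimpleGraph V) (i : Quotient G.triangleSetoid) :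
    (G.triangleClass i).TriangleGrows := by
  intro S a b p q hab ha hb hpq hnot
  by_contra! hno
  have hchain : Relation.ReflTransGen G.ShareTriangle s(a, b) s(p, q) :=
    Quotient.exact (hab.2.trans hpq.2.symm)
  have : ∀ f, Relation.ReflTransGen G.ShareTriangle s(a, b) f →
      (Quotient.mk G.triangleSetoid f = i) ∧ ∀ v ∈ f, v ∈ S := by
    intro f hf
    induction hf with
    | refl => exact ⟨hab.2, by simp [ha, hb]⟩
    | @tail e f _ hef ih =>
      refine ⟨hef.mk_eq ▸ ih.1, ?_⟩
      obtain ⟨x, y, z, hxy, hxz, hyz, rfl, rfl⟩ := hef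
      have hx : x ∈ S := ih.2 x (by simp)
      have hy : y ∈ S := ih.2 y (by simp)
      have hz : z ∈ S := by
        by_contra hz
        obtain ⟨h1, h2⟩ := triangleClass_of_triangle (i := i) ⟨hxy, ih.1⟩ hxz hyz
        exact hno x y z hx hy hz ⟨hxy, ih.1⟩ h1 h2
      simp [hx, hz]
  have h := (this _ hchain).2
  exact hnot ⟨h p (by simp), h q (by simp)⟩

variable [Fintype V]

/-- The classes that contain an edge. -/
noncomputable def triangleClasses (G : SimpleGraph V) : Finset (Quotient G.triangleSetoid) :=
  G.edgeFinset.image (Quotient.mk _)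

lemma mem_triangleClasses {G : SimpleGraph V} {i : Quotient G.triangleSetoid} :
    i ∈ G.triangleClasses ↔ ∃ a b, (G.triangleClass i).Adj a b := by
  simp only [triangleClasses, Finset.mem_image, mem_edgeFinset]
  constructor
  · rintro ⟨e, he, rfl⟩
    induction e with
    | _ a b => exact ⟨a, b, he, rfl⟩
  · rintro ⟨a, b, h, h'⟩
    exact ⟨s(a, b), h, h'⟩

lemma sum_ncard_triangleClass (G : SimpleGraph V) :
    ∑ i ∈ G.triangleClasses, (G.triangleClass i).edgeSet.ncard = G.edgeSet.ncard := by
  rw [← coe_edgeFinset G, Set.ncard_coe_finset,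
    Finset.card_eq_sum_card_image (Quotient.mk G.triangleSetoid) G.edgeFinset]
  refine Finset.sum_congr rfl fun i _ => ?_
  rw [← Set.ncard_coe_finset]
  congr 1
  ext e
  induction e with
  | _ a b => simp [triangleClass]

/-- The vertices of a class that also lie in another class. -/
noncomputable def attachments (G : SimpleGraph V) (i : Quotient G.triangleSetoid) : Finset V :=
  (G.triangleClass i).supp.filter fun v => ∃ j, j ≠ i ∧ v ∈ (G.triangleClass j).supp

lemma three_le_card_supp_triangleClass {G : SimpleGraph V}
    (htri : ∀ a b, G.Adj a b → ∃ c, G.Adj a c ∧ G.Adj b c) {i : Quotient G.triangleSetoid}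
    (hi : i ∈ G.triangleClasses) : 3 ≤ (G.triangleClass i).supp.card := by
  obtain ⟨a, b, hab⟩ := mem_triangleClasses.1 hi
  obtain ⟨c, hac, hbc⟩ := htri a b hab.1
  obtain ⟨hac', hbc'⟩ := triangleClass_of_triangle hab hac hbc
  rw [← Finset.card_eq_three.2 ⟨a, b, c, hab.ne, hac.ne, hbc.ne, rfl⟩]
  apply Finset.card_le_card
  intro v hv
  simp only [Finset.mem_insert, Finset.mem_singleton] at hv
  rcases hv with rfl | rfl | rfl
  exacts [mem_supp.2 ⟨b, hab⟩, mem_supp.2 ⟨a, hab.symm⟩, mem_supp.2 ⟨a, hac'.symm⟩]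

/-- Only attachments have edges outside the class, so they separate its other vertices from the
rest. Both classes have at least three vertices, so fewer than three attachments leave vertices on
both sides. -/
lemma IsKConnected.three_le_card_attachments {G : SimpleGraph V} (hG : G.IsKConnected 3)
    (htri : ∀ a b, G.Adj a b → ∃ c, G.Adj a c ∧ G.Adj b c) {i j : Quotient G.triangleSetoid}
    (hi : i ∈ G.triangleClasses) (hj : j ∈ G.triangleClasses) (hij : j ≠ i) :
    3 ≤ (G.attachments i).card := by
  by_contra! hlt
  obtain ⟨u, hu, hua⟩ := Finset.exists_mem_notMem_of_card_lt_card
    (hlt.trans_le (three_le_card_supp_triangleClass htri hi))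
  obtain ⟨w, hw, hwa⟩ := Finset.exists_mem_notMem_of_card_lt_card
    (hlt.trans_le (three_le_card_supp_triangleClass htri hj))
  have hwi : w ∉ (G.triangleClass i).supp := fun h =>
    hwa (Finset.mem_filter.2 ⟨h, j, hij, hw⟩)
  refine hwi (hG.propagate (P := (· ∈ (G.triangleClass i).supp)) hlt ?_ hua hwa hu)
  intro x y hx hxa _ hxy
  by_cases hc : Quotient.mk G.triangleSetoid s(x, y) = i
  · have hxy' : (G.triangleClass i).Adj x y := ⟨hxy, hc⟩
    exact mem_supp.2 ⟨x, hxy'.symm⟩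
  · exact (hxa (Finset.mem_filter.2 ⟨hx, _, hc, mem_supp.2 ⟨y, hxy, rfl⟩⟩)).elim

/-- A graph with at least two triangle classes has at least `2n` edges. -/
lemma IsKConnected.two_mul_card_le_of_ne {G : SimpleGraph V} (hG : G.IsKConnected 3)
    (htri : ∀ a b, G.Adj a b → ∃ c, G.Adj a c ∧ G.Adj b c) {i j : Quotient G.triangleSetoid}
    (hi : i ∈ G.triangleClasses) (hj : j ∈ G.triangleClasses) (hij : j ≠ i) :
    2 * Fintype.card V ≤ G.edgeSet.ncard := by
  let I : V → Finset (Quotient G.triangleSetoid) := fun v =>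
    G.triangleClasses.filter fun k => v ∈ (G.triangleClass k).supp
  -- An attachment weighs 1, so a class on `s` vertices weighs at most `2s - 3`, while a vertex
  -- collects at least 2 over all its classes.
  let w : V → ℕ := fun v => if 2 ≤ (I v).card then 1 else 2
  have hclass : ∀ k ∈ G.triangleClasses,
      ∑ v ∈ (G.triangleClass k).supp, w v ≤ (G.triangleClass k).edgeSet.ncard := by
    intro k hk
    obtain ⟨l, hl, hlk⟩ : ∃ l ∈ G.triangleClasses, l ≠ k := by
      by_cases h : i = k
      · exact ⟨j, hj, h ▸ hij⟩
      · exact ⟨i, hi, h⟩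
    have hatt := hG.three_le_card_attachments htri hk hl hlk
    obtain ⟨a, b, hab⟩ := mem_triangleClasses.1 hk
    obtain ⟨c, hac, hbc⟩ := htri a b hab.1
    obtain ⟨hac', hbc'⟩ := triangleClass_of_triangle hab hac hbc
    have hsz := (G.triangleGrows_triangleClass k).card_supp_le hab hac' hbc'
    have hw : ∑ v ∈ (G.triangleClass k).supp, (w v + if v ∈ G.attachments k then 1 else 0) ≤
        ∑ v ∈ (G.triangleClass k).supp, 2 := by
      refine Finset.sum_le_sum fun v hv => ?_
      by_cases hva : v ∈ G.attachments k
      · obtain ⟨-, l, hlk, hvl⟩ := Finset.mem_filter.1 hva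
        have hl : l ∈ G.triangleClasses := by
          obtain ⟨y, hy⟩ := mem_supp.1 hvl
          exact mem_triangleClasses.2 ⟨v, y, hy⟩
        have h2 : 2 ≤ (I v).card := by
          rw [← Finset.card_pair hlk]
          apply Finset.card_le_card
          intro x hx
          simp only [Finset.mem_insert, Finset.mem_singleton] at hx
          rcases hx with rfl | rfl
          · exact Finset.mem_filter.2 ⟨hl, hvl⟩
          · exact Finset.mem_filter.2 ⟨hk, hv⟩
        simp [w, h2, hva]
      · simp only [hva, if_false, add_zero, w]
        split_ifs <;> omega
    have hsub : G.attachments k ⊆ (G.triangleClass k).supp := Finset.filter_subset _ _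
    rw [Finset.sum_add_distrib, Finset.sum_boole, Finset.sum_const, smul_eq_mul,
      Finset.filter_mem_eq_inter, Finset.inter_eq_right.2 hsub] at hw
    simp only [Nat.cast_id] at hw
    omega
  have hvert : ∀ v, 2 ≤ (I v).card * w v := by
    intro v
    have hpos : 0 < (I v).card := by
      obtain ⟨y, hy⟩ := Finset.card_pos.1
        (lt_of_lt_of_le (by norm_num) (hG.three_le_card_nbrsIn v))
      have hvy := (mem_nbrsIn.1 hy).2
      have h : (G.triangleClass (Quotient.mk _ s(v, y))).Adj v y := ⟨hvy, rfl⟩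
      exact Finset.card_pos.2 ⟨_, Finset.mem_filter.2
        ⟨mem_triangleClasses.2 ⟨v, y, h⟩, mem_supp.2 ⟨y, h⟩⟩⟩
    simp only [w]
    split_ifs <;> omega
  -- Double counting of pairs of a vertex and a class containing it.
  calc 2 * Fintype.card V = ∑ _v : V, 2 := by simp [mul_comm]
    _ ≤ ∑ v : V, (I v).card * w v := Finset.sum_le_sum fun v _ => hvert v
    _ = ∑ v : V, ∑ k ∈ I v, w v := by simp
    _ = ∑ k ∈ G.triangleClasses, ∑ v ∈ (G.triangleClass k).supp, w v := by
      refine Finset.sum_comm' fun v k => ?_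
      simp [I, and_comm]
    _ ≤ ∑ k ∈ G.triangleClasses, (G.triangleClass k).edgeSet.ncard := Finset.sum_le_sum hclass
    _ = G.edgeSet.ncard := G.sum_ncard_triangleClass

lemma IsKConnected.triangleGrows_or_two_mul_card_le {G : SimpleGraph V} (hG : G.IsKConnected 3)
    (htri : ∀ a b, G.Adj a b → ∃ c, G.Adj a c ∧ G.Adj b c) :
    G.TriangleGrows ∨ 2 * Fintype.card V ≤ G.edgeSet.ncard := by
  by_cases h : ∃ i ∈ G.triangleClasses, ∃ j ∈ G.triangleClasses, j ≠ i
  · obtain ⟨i, hi, j, hj, hij⟩ := h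
    exact Or.inr (hG.two_mul_card_le_of_ne htri hi hj hij)
  · push Not at h
    left
    intro S a b p q hab ha hb hpq hnot
    have hp : (G.triangleClass (Quotient.mk _ s(p, q))).Adj p q := ⟨hpq, rfl⟩
    have ha' : (G.triangleClass (Quotient.mk _ s(a, b))).Adj a b := ⟨hab, rfl⟩
    have heq := h _ (mem_triangleClasses.2 ⟨a, b, ha'⟩) _ (mem_triangleClasses.2 ⟨p, q, hp⟩)
    rw [heq] at hp
    obtain ⟨c, d, x, hc, hd, hx, h1, h2, h3⟩ :=
      G.triangleGrows_triangleClass _ S a b p q ha' ha hb hp hnot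
    exact ⟨c, d, x, hc, hd, hx, h1.1, h2.1, h3.1⟩

lemma TriangleGrows.two_mul_card_le {G : SimpleGraph V} (hG : G.TriangleGrows)
    (hn : 4 ≤ Fintype.card V) (hdeg : ∀ x, 3 ≤ (G.nbrsIn Finset.univ x).card)
    (htri : ∀ a b, G.Adj a b → ∃ c, G.Adj a c ∧ G.Adj b c) :
    2 * Fintype.card V ≤ G.edgeSet.ncard + 2 := by
  obtain ⟨x⟩ : Nonempty V := Fintype.card_pos_iff.1 (by omega)
  obtain ⟨y, hy⟩ := Finset.card_pos.1 (lt_of_lt_of_le (by norm_num) (hdeg x))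
  have hxy := (mem_nbrsIn.1 hy).2
  obtain ⟨z, hxz, hyz⟩ := htri _ _ hxy
  have hc3 := Finset.card_le_three (a := x) (b := y) (c := z)
  exact hG.card_edgeSet_ge hdeg 0 _ {x, y, z} le_rfl
    (fun h => by rw [h, Finset.card_univ] at hc3; omega) ⟨x, y, by simp, by simp, hxy⟩
    (by have := three_le_card_edgesIn_of_triangle hxy hxz hyz; omega)

end

end SimpleGraph

/-! ### The bound and the characterization of equality -/

theorem theorem3 {V : Type*} [Fintype V] (G : SimpleGraph V) (n : ℕ)
    (hn : Fintype.card V = n) (hconn : G.IsKConnected 3) (hpan : G.IsEdgePancyclic) :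
    2 * n - 2 ≤ G.edgeSet.ncard ∧
      (G.edgeSet.ncard = 2 * n - 2 ↔ Nonempty (G ≃g SimpleGraph.wheel n)) := by
  classical
  have hcard : 4 ≤ Fintype.card V := hconn.1
  have hdeg := fun x => hconn.three_le_card_nbrsIn x
  have htri : ∀ a b, G.Adj a b → ∃ c, G.Adj a c ∧ G.Adj b c := fun a b hab =>
    hpan.exists_triangle (by omega) hab
  have hor := hconn.triangleGrows_or_two_mul_card_le htri
  obtain ⟨m, rfl⟩ : ∃ m, n = m + 4 := ⟨n - 4, by omega⟩
  refine ⟨?_, fun hE => ?_, fun ⟨e⟩ => ?_⟩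
  · rcases hor with h | h
    · have := h.two_mul_card_le hcard hdeg htri
      omega
    · omega
  · have hgrow := hor.resolve_right (by omega)
    have hE' : G.edgeSet.ncard + 2 = 2 * Fintype.card V := by omega
    obtain ⟨b, hb⟩ := hgrow.exists_universal hcard hdeg htri hE'
    simp only [SimpleGraph.card_nbrsIn_univ] at hdeg
    obtain ⟨x, hx⟩ := Fintype.exists_ne_of_one_lt_card (by omega) b
    -- A Hamilton cycle, from pancyclicity with `k = n` at any edge.
    obtain ⟨v, c, hc, hlen, -⟩ := hpan (m + 4) (by omega) hn.ge s(b, x) (hb x hx)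
    refine SimpleGraph.nonempty_iso_wheel hn
      ((SimpleGraph.cycleGraph_isContained_iff (by omega)).2 ⟨v, c, hc, hlen⟩) hb fun w hw => ?_
    convert SimpleGraph.degree_eq_three_of_universal (fun w => ?_) hE' hb hw
    convert hdeg w
  · have h := e.card_edgeFinset_eq
    rw [← Set.ncard_coe_finset, ← Set.ncard_coe_finset, SimpleGraph.coe_edgeFinset,
      SimpleGraph.coe_edgeFinset, SimpleGraph.ncard_edgeSet_wheel] at h
    omega
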